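/- Let $d\ge 2$ and let $\phi:\mathbb{R}^d\to[-1,1]$ be measurable. Suppose that the distributional gradient of $\phi$ is a function $\nabla\phi\in L^2(\mathbb{R}^d;\mathbb{R}^d)$ (that is, $\int_{\mathbb{R}^d}\phi\,\partial_i\psi\,dx=-\int_{\mathbb{R}^d}(\nabla\phi)_i\,\psi\,dx$ for all $\psi\in C_c^\infty(\mathbb{R}^d)$ and $1\le i\le d$), and that $\sqrt{1-\phi^2}\in L^2(\mathbb{R}^d)$. Then $1-\phi\in L^1(\mathbb{R}^d)$ or $1+\phi\in L^1(\mathbb{R}^d)$. -/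

import Mathlib

open MeasureTheory Set
open scoped ContDiff

/-- `G` is the weak (distributional) gradient of `φ` on `ℝ^d`: both functions are locally
integrable, and `∫ φ ∂ᵢψ = - ∫ Gᵢ ψ` for every test function `ψ ∈ C_c^∞(ℝ^d)` and every
coordinate `i`. -/
structure HasWeakGradient {d : ℕ} (φ : EuclideanSpace ℝ (Fin d) → ℝ)
    (G : EuclideanSpace ℝ (Fin d) → EuclideanSpace ℝ (Fin d)) : Prop where
  locallyIntegrable : LocallyIntegrable φ volume
  locallyIntegrable_grad : LocallyIntegrable G volume
  integral_eq : ∀ ψ : EuclideanSpace ℝ (Fin d) → ℝ, ContDiff ℝ ∞ ψ → HasCompactSupport ψ →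
    ∀ i : Fin d,
      ∫ x, φ x * fderiv ℝ ψ x (EuclideanSpace.single i 1) = - ∫ x, G x i * ψ x

/-!
The argument combines the Modica-Mortola trick with the Gagliardo-Nirenberg-Sobolev inequality.

If `f` is `C¹` with values in `[-1, 1]`, and `∇f` and `1 - f²` are both in `L²`, then
`w = f - f³ / 3` has gradient `(1 - f²) ∇f`, which is in `L¹`. In dimension at least two a `C¹`
function with integrable gradient is, up to an additive constant, in `L^{d/(d-1)}`, so at most one
of two disjoint level sets `{w ≤ a}` and `{b ≤ w}` can have infinite measure
(`measure_le_lt_top_or_measure_ge_lt_top`). To see this without knowing the constant, the Sobolev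
inequality for compactly supported functions is applied to `χ_R (w - c_R)`, where `χ_R` is a cutoff
at scale `R`. The error term `|∇χ_R| |w - c_R|` is controlled, uniformly in `R`, by the `L¹`
Poincaré inequality `exists_lintegral_ball_enorm_sub_le`, which in turn comes from averaging the
estimate `∫ |w(x + h) - w(x)| dx ≤ |h| ∫ |∇w|` over `|h| < 2R`. This gives a bound,
independent of `R`, on the measure of one of the two level sets inside the ball of radius `R`,
and `R → ∞` finishes.

The function `φ` of the theorem is only weakly differentiable, and is replaced by one fixed
mollification `f = φ ⋆ η` (`HasWeakGradient.exists_contDiff_approx`). Its gradient is `G ⋆ η`,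
hence in `L²`, and `φ - f` is in `L²` because `‖φ(· + h) - φ‖₂ ≤ |h| ‖G‖₂`. So
`1 - f² = (1 - φ²) + (φ - f)(φ + f)` is in `L²` as well, and the first paragraph applies to `f`.
Finally `{|φ - f| ≥ 1/4}` has finite measure, so `{φ ≤ -1/2}` or `{φ ≥ 1/2}` does too. In the
first case `1 - φ` is dominated by `2 (1 - φ²)` off a set of finite measure, and in the second case
the same holds for `1 + φ`.
-/

open Filter Topology Metric
open scoped ENNReal NNReal Convolution

/-! ### Integral inequalities for translates -/

/-- Jensen's inequality for the square and a probability measure. -/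
theorem sq_lintegral_le_lintegral_sq {α : Type*} [MeasurableSpace α] (ν : Measure α)
    [IsProbabilityMeasure ν] {g : α → ℝ≥0∞} (hg : AEMeasurable g ν) :
    (∫⁻ x, g x ∂ν) ^ 2 ≤ ∫⁻ x, g x ^ 2 ∂ν := by
  have h := eLpNorm_le_eLpNorm_of_exponent_le (p := 1) (q := 2) (μ := ν) (f := g) one_le_two
    hg.aestronglyMeasurable
  have h2 := eLpNorm_nnreal_pow_eq_lintegral (f := g) (μ := ν) (p := 2) two_ne_zero
  rw [eLpNorm_one_eq_lintegral_enorm] at h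
  simp only [enorm_eq_self, NNReal.coe_ofNat, ENNReal.rpow_ofNat, ENNReal.coe_ofNat] at h h2
  rw [← h2]
  gcongr

section

variable {E : Type*} [NormedAddCommGroup E] [NormedSpace ℝ E]

theorem enorm_sub_le_lintegral_enorm_fderiv {f : E → ℝ} (hf : ContDiff ℝ 1 f) (x h : E) :
    ‖f (x + h) - f x‖ₑ ≤ ‖h‖ₑ * ∫⁻ t in Icc (0 : ℝ) 1, ‖fderiv ℝ f (x + t • h)‖ₑ := by
  have hd : ∀ t : ℝ, HasDerivAt (fun t : ℝ => f (x + t • h)) (fderiv ℝ f (x + t • h) h) t := by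
    intro t
    have h1 : HasDerivAt (fun t : ℝ => x + t • h) h t := by
      simpa using ((hasDerivAt_id t).smul_const h).const_add x
    exact ((hf.differentiable one_ne_zero _).hasFDerivAt).comp_hasDerivAt t h1
  have hc : Continuous (fun t : ℝ => fderiv ℝ f (x + t • h) h) := by
    have := hf.continuous_fderiv one_ne_zero
    fun_prop
  have hi := intervalIntegral.integral_eq_sub_of_hasDerivAt (a := 0) (b := 1)
    (fun t _ => hd t) (hc.intervalIntegrable _ _)
  simp only [one_smul, zero_smul, add_zero] at hi
  rw [← hi, intervalIntegral.integral_of_le zero_le_one, ← integral_Icc_eq_integral_Ioc,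
    ← lintegral_const_mul' _ _ enorm_ne_top]
  refine (enorm_integral_le_lintegral_enorm _).trans (lintegral_mono fun t => ?_)
  rw [mul_comm]
  exact ContinuousLinearMap.le_opENorm _ _

variable [FiniteDimensional ℝ E] [MeasurableSpace E] [BorelSpace E]

/-- Translation estimate in `L¹`: `‖f(· + h) - f‖₁ ≤ ‖h‖ ‖∇f‖₁`. -/
theorem lintegral_enorm_translate_sub_le (μ : Measure E) [μ.IsAddHaarMeasure]
    {f : E → ℝ} (hf : ContDiff ℝ 1 f) (h : E) :
    ∫⁻ x, ‖f (x + h) - f x‖ₑ ∂μ ≤ ‖h‖ₑ * ∫⁻ x, ‖fderiv ℝ f x‖ₑ ∂μ := by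
  have hc := hf.continuous_fderiv one_ne_zero
  calc ∫⁻ x, ‖f (x + h) - f x‖ₑ ∂μ
      ≤ ∫⁻ x, ‖h‖ₑ * (∫⁻ t in Icc (0 : ℝ) 1, ‖fderiv ℝ f (x + t • h)‖ₑ) ∂μ :=
        lintegral_mono fun x => enorm_sub_le_lintegral_enorm_fderiv hf x h
    _ = ‖h‖ₑ * ∫⁻ t in Icc (0 : ℝ) 1, ∫⁻ x, ‖fderiv ℝ f (x + t • h)‖ₑ ∂μ := by
        rw [lintegral_const_mul' _ _ enorm_ne_top, lintegral_lintegral_swap]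
        exact Continuous.aemeasurable (by fun_prop)
    _ = ‖h‖ₑ * ∫⁻ x, ‖fderiv ℝ f x‖ₑ ∂μ := by
        simp_rw [lintegral_add_right_eq_self (μ := μ) (fun y => ‖fderiv ℝ f y‖ₑ)]
        simp

/-- Translation estimate in `L²`: `‖f(· + h) - f‖₂ ≤ ‖h‖ ‖∇f‖₂`, with both sides squared. -/
theorem lintegral_enorm_translate_sub_sq_le (μ : Measure E) [μ.IsAddHaarMeasure]
    {f : E → ℝ} (hf : ContDiff ℝ 1 f) (h : E) :
    ∫⁻ x, ‖f (x + h) - f x‖ₑ ^ 2 ∂μ ≤ ‖h‖ₑ ^ 2 * ∫⁻ x, ‖fderiv ℝ f x‖ₑ ^ 2 ∂μ := by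
  have hc := hf.continuous_fderiv one_ne_zero
  have : IsProbabilityMeasure (volume.restrict (Icc (0 : ℝ) 1)) := ⟨by simp⟩
  calc ∫⁻ x, ‖f (x + h) - f x‖ₑ ^ 2 ∂μ
      ≤ ∫⁻ x, ‖h‖ₑ ^ 2 * (∫⁻ t in Icc (0 : ℝ) 1, ‖fderiv ℝ f (x + t • h)‖ₑ ^ 2) ∂μ := by
        refine lintegral_mono fun x => ?_
        refine (pow_le_pow_left₀ zero_le (enorm_sub_le_lintegral_enorm_fderiv hf x h) 2).trans ?_
        rw [mul_pow]
        gcongr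
        exact sq_lintegral_le_lintegral_sq _ (Continuous.aemeasurable (by fun_prop))
    _ = ‖h‖ₑ ^ 2 * ∫⁻ t in Icc (0 : ℝ) 1, ∫⁻ x, ‖fderiv ℝ f (x + t • h)‖ₑ ^ 2 ∂μ := by
        rw [lintegral_const_mul' _ _ (ENNReal.pow_ne_top enorm_ne_top), lintegral_lintegral_swap]
        exact Continuous.aemeasurable (by fun_prop)
    _ = ‖h‖ₑ ^ 2 * ∫⁻ x, ‖fderiv ℝ f x‖ₑ ^ 2 ∂μ := by
        simp_rw [lintegral_add_right_eq_self (μ := μ) (fun y => ‖fderiv ℝ f y‖ₑ ^ 2)]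
        simp

/-- An `L¹` Poincaré inequality on balls centred at the origin, with the gradient integrated over
the whole space. The constant `c` is the value of `w` at a well-chosen point of the ball, which
exists because the double integral of `|w x - w y|` over the ball is bounded by the translation
estimate. -/
theorem exists_lintegral_ball_enorm_sub_le (μ : Measure E) [μ.IsAddHaarMeasure]
    {w : E → ℝ} (hw : ContDiff ℝ 1 w) {r : ℝ} (hr : 0 < r) :
    ∃ c : ℝ, ∫⁻ x in ball (0 : E) r, ‖w x - c‖ₑ ∂μ ≤
      ENNReal.ofReal (2 ^ (Module.finrank ℝ E + 1) * r) * ∫⁻ x, ‖fderiv ℝ w x‖ₑ ∂μ := by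
  have hcw := hw.continuous
  set I := ∫⁻ x, ‖fderiv ℝ w x‖ₑ ∂μ with hI
  set F : E → ℝ≥0∞ := fun y => ∫⁻ h in ball (0 : E) (2 * r), ‖w (y + h) - w y‖ₑ ∂μ with hF
  have hm : Measurable F := Measurable.lintegral_prod_right' (f := fun p : E × E =>
    ‖w (p.1 + p.2) - w p.1‖ₑ) (Continuous.measurable (by fun_prop))
  have h0 : μ (ball (0 : E) r) ≠ 0 := (measure_ball_pos μ _ hr).ne'
  have htop : μ (ball (0 : E) r) ≠ ⊤ := measure_ball_lt_top.ne
  obtain ⟨y, hy, hyF⟩ := exists_le_setLAverage h0 htop hm.aemeasurable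
  refine ⟨w y, ?_⟩
  have htot : ∫⁻ y in ball (0 : E) r, F y ∂μ ≤
      ENNReal.ofReal (2 ^ (Module.finrank ℝ E + 1) * r) * I * μ (ball (0 : E) r) := by
    calc ∫⁻ y in ball (0 : E) r, F y ∂μ ≤ ∫⁻ y, F y ∂μ := setLIntegral_le_lintegral _ _
      _ = ∫⁻ h in ball (0 : E) (2 * r), ∫⁻ y, ‖w (y + h) - w y‖ₑ ∂μ ∂μ := by
          rw [hF, lintegral_lintegral_swap]
          exact Continuous.aemeasurable (by fun_prop)
      _ ≤ ∫⁻ h in ball (0 : E) (2 * r), ENNReal.ofReal (2 * r) * I ∂μ := by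
          refine setLIntegral_mono' measurableSet_ball fun h hh => ?_
          refine (lintegral_enorm_translate_sub_le μ hw h).trans ?_
          gcongr
          rw [← ofReal_norm]
          exact ENNReal.ofReal_le_ofReal (by simpa using (mem_ball_zero_iff.1 hh).le)
      _ = ENNReal.ofReal (2 ^ (Module.finrank ℝ E + 1) * r) * I * μ (ball (0 : E) r) := by
          rw [setLIntegral_const, Measure.addHaar_ball_mul_of_pos _ _ two_pos, pow_succ,
            mul_assoc (2 ^ _), ENNReal.ofReal_mul (p := 2 ^ Module.finrank ℝ E) (by positivity)]
          ring
  -- substitute `x = y + h`; if `y` and `y + h` lie in the ball of radius `r` then `‖h‖ < 2 * r`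
  calc ∫⁻ x in ball (0 : E) r, ‖w x - w y‖ₑ ∂μ
      = ∫⁻ h, (ball (0 : E) r).indicator (fun x => ‖w x - w y‖ₑ) (y + h) ∂μ := by
        rw [lintegral_add_left_eq_self, lintegral_indicator measurableSet_ball]
    _ ≤ ∫⁻ h, (ball (0 : E) (2 * r)).indicator (fun h => ‖w (y + h) - w y‖ₑ) h ∂μ := by
        refine lintegral_mono fun h => ?_
        by_cases hh : y + h ∈ ball (0 : E) r
        · have : h ∈ ball (0 : E) (2 * r) := by
            rw [mem_ball_zero_iff] at *
            have := norm_sub_le (y + h) y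
            rw [add_sub_cancel_left] at this
            linarith
          simp [hh, this]
        · simp [hh]
    _ = F y := lintegral_indicator measurableSet_ball _
    _ ≤ (∫⁻ y in ball (0 : E) r, F y ∂μ) / μ (ball (0 : E) r) := by
        rwa [setLAverage_eq] at hyF
    _ ≤ _ := ENNReal.div_le_of_le_mul htot

end

/-! ### A Sobolev dichotomy for functions with integrable gradient -/

/-- Cutoff functions at every scale `R`: equal to `1` on the ball of radius `R`, with gradient of
size at most `K / R` and supported in the ball of radius `3 * R`. -/
theorem exists_cutoff (E : Type*) [NormedAddCommGroup E] [NormedSpace ℝ E]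
    [FiniteDimensional ℝ E] :
    ∃ K : ℝ≥0, ∀ R : ℝ, 0 < R → ∃ χ : E → ℝ, ContDiff ℝ 1 χ ∧ HasCompactSupport χ ∧
      (∀ x, ‖χ x‖ₑ ≤ 1) ∧ (∀ x ∈ ball (0 : E) R, χ x = 1) ∧
      ∀ x, ‖fderiv ℝ χ x‖ₑ ≤
        (ball (0 : E) (3 * R)).indicator (fun _ => ENNReal.ofReal (K / R)) x := by
  let b : ContDiffBump (0 : E) := ⟨1, 2, one_pos, one_lt_two⟩
  have hb : ContDiff ℝ 1 b := b.contDiff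
  obtain ⟨K, hK⟩ := (hb.continuous_fderiv one_ne_zero).bounded_above_of_compact_support
    (b.hasCompactSupport.fderiv ℝ)
  lift K to ℝ≥0 using (norm_nonneg _).trans (hK 0)
  refine ⟨K, fun R hR => ⟨fun x => b (R⁻¹ • x), by fun_prop, ?_, ?_, ?_, ?_⟩⟩
  · exact b.hasCompactSupport.comp_homeomorph (Homeomorph.smulOfNeZero R⁻¹ (inv_ne_zero hR.ne'))
  · intro x
    rw [← ofReal_norm, Real.norm_of_nonneg b.nonneg]
    simpa using b.le_one
  · intro x hx
    refine b.one_of_mem_closedBall ?_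
    rw [mem_closedBall_zero_iff, norm_smul, norm_inv, Real.norm_of_nonneg hR.le,
      inv_mul_le_iff₀ hR]
    exact (mem_ball_zero_iff.1 hx).le.trans_eq (mul_one R).symm
  · intro x
    have hd : HasFDerivAt (fun x : E => b (R⁻¹ • x))
        ((fderiv ℝ b (R⁻¹ • x)).comp (R⁻¹ • ContinuousLinearMap.id ℝ E)) x :=
      ((hb.differentiable one_ne_zero _).hasFDerivAt).comp x
        ((hasFDerivAt_id x).const_smul R⁻¹)
    rw [hd.fderiv, ContinuousLinearMap.comp_smul, ContinuousLinearMap.comp_id]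
    by_cases hx : x ∈ ball (0 : E) (3 * R)
    · rw [indicator_of_mem hx, ← ofReal_norm]
      refine ENNReal.ofReal_le_ofReal ?_
      rw [norm_smul, norm_inv, Real.norm_of_nonneg hR.le, div_eq_inv_mul]
      exact mul_le_mul_of_nonneg_left (hK _) (by positivity)
    · have : fderiv ℝ b (R⁻¹ • x) = 0 := by
        refine image_eq_zero_of_notMem_tsupport fun hmem => hx ?_
        have := tsupport_fderiv_subset ℝ hmem
        rw [b.tsupport_eq, mem_closedBall_zero_iff, norm_smul, norm_inv,
          Real.norm_of_nonneg hR.le, inv_mul_le_iff₀ hR] at this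
        rw [mem_ball_zero_iff]
        change ‖x‖ ≤ R * 2 at this
        linarith
      rw [this, smul_zero, ← ofReal_norm, norm_zero, ENNReal.ofReal_zero]
      exact zero_le

section

variable {E : Type*} [NormedAddCommGroup E] [NormedSpace ℝ E] [FiniteDimensional ℝ E]
  [MeasurableSpace E] [BorelSpace E]

/-- Poincaré-Sobolev inequality on balls: up to a constant depending on the ball, a function with
integrable gradient is in `L^{d/(d-1)}`, with a bound that does not depend on the radius. -/
theorem exists_eLpNorm_ball_sub_le (μ : Measure E) [μ.IsAddHaarMeasure] {p : ℝ≥0}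
    (hp : NNReal.HolderConjugate (Module.finrank ℝ E) p) {w : E → ℝ} (hw : ContDiff ℝ 1 w)
    (hI : ∫⁻ x, ‖fderiv ℝ w x‖ₑ ∂μ ≠ ⊤) :
    ∃ C : ℝ≥0∞, C ≠ ⊤ ∧ ∀ R : ℝ, 0 < R → ∃ c : ℝ,
      eLpNorm (fun x => w x - c) p (μ.restrict (ball (0 : E) R)) ≤ C := by
  obtain ⟨K, hK⟩ := exists_cutoff E
  set I := ∫⁻ x, ‖fderiv ℝ w x‖ₑ ∂μ
  refine ⟨eLpNormLESNormFDerivOneConst μ p *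
    (I + ENNReal.ofReal (K * (2 ^ (Module.finrank ℝ E + 1) * 3)) * I), by finiteness, ?_⟩
  intro R hR
  obtain ⟨χ, hχ, hχc, hχ1, hχR, hχ'⟩ := hK R hR
  obtain ⟨c, hc⟩ := exists_lintegral_ball_enorm_sub_le μ hw (r := 3 * R) (by positivity)
  refine ⟨c, ?_⟩
  have hu : ContDiff ℝ 1 (fun x => χ x * (w x - c)) := hχ.mul (hw.sub contDiff_const)
  have hcw := hw.continuous
  calc eLpNorm (fun x => w x - c) p (μ.restrict (ball (0 : E) R))
      = eLpNorm (fun x => χ x * (w x - c)) p (μ.restrict (ball (0 : E) R)) := by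
        refine eLpNorm_congr_ae ((ae_restrict_iff' measurableSet_ball).2
          (.of_forall fun x hx => ?_))
        simp [hχR x hx]
    _ ≤ eLpNorm (fun x => χ x * (w x - c)) p μ := eLpNorm_restrict_le _ _ _ _
    _ ≤ _ := eLpNorm_le_eLpNorm_fderiv_one μ hu hχc.mul_right hp
    _ ≤ _ := ?_
  gcongr
  rw [eLpNorm_one_eq_lintegral_enorm]
  calc ∫⁻ x, ‖fderiv ℝ (fun x => χ x * (w x - c)) x‖ₑ ∂μ
      ≤ ∫⁻ x, ‖fderiv ℝ w x‖ₑ + ENNReal.ofReal (K / R) *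
          (ball (0 : E) (3 * R)).indicator (fun x => ‖w x - c‖ₑ) x ∂μ := by
        refine lintegral_mono fun x => ?_
        have h1 := hχ.differentiable one_ne_zero x
        have h2 := hw.differentiable one_ne_zero x
        rw [fderiv_fun_mul h1 (h2.sub_const c), fderiv_sub_const]
        refine (enorm_add_le (χ x • fderiv ℝ w x) _).trans (add_le_add ?_ ?_)
        · rw [enorm_smul]
          exact mul_le_of_le_one_left zero_le (hχ1 x)
        · rw [enorm_smul, mul_comm]
          refine (mul_le_mul_left (hχ' x) _).trans ?_
          by_cases hx : x ∈ ball (0 : E) (3 * R) <;> simp [hx]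
    _ = I + ENNReal.ofReal (K / R) * ∫⁻ x in ball (0 : E) (3 * R), ‖w x - c‖ₑ ∂μ := by
        have hm : Measurable fun x => ‖w x - c‖ₑ := Continuous.measurable (by fun_prop)
        rw [lintegral_add_right _ ((hm.indicator measurableSet_ball).const_mul _),
          lintegral_const_mul _ (hm.indicator measurableSet_ball),
          lintegral_indicator measurableSet_ball]
    _ ≤ I + ENNReal.ofReal (K / R) *
          (ENNReal.ofReal (2 ^ (Module.finrank ℝ E + 1) * (3 * R)) * I) := by gcongr
    _ = I + ENNReal.ofReal (K * (2 ^ (Module.finrank ℝ E + 1) * 3)) * I := by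
        rw [← mul_assoc, ← ENNReal.ofReal_mul (by positivity)]
        congr 3
        field_simp

/-- In dimension at least two, a `C¹` function with integrable gradient cannot be at most `a` and at
least `b > a` on two sets of infinite measure. -/
theorem measure_le_lt_top_or_measure_ge_lt_top (μ : Measure E) [μ.IsAddHaarMeasure]
    (hE : 2 ≤ Module.finrank ℝ E) {w : E → ℝ} (hw : ContDiff ℝ 1 w)
    (hI : ∫⁻ x, ‖fderiv ℝ w x‖ₑ ∂μ ≠ ⊤) {a b : ℝ} (hab : a < b) :
    μ {x | w x ≤ a} < ⊤ ∨ μ {x | b ≤ w x} < ⊤ := by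
  have hcw := hw.continuous
  have h1 : (1 : ℝ≥0) < Module.finrank ℝ E := by exact_mod_cast hE
  have hp := NNReal.HolderConjugate.conjExponent h1
  set p := NNReal.conjExponent (Module.finrank ℝ E)
  have hp0 : (p : ℝ≥0∞) ≠ 0 := by exact_mod_cast hp.symm.ne_zero
  obtain ⟨C, hC, hCR⟩ := exists_eLpNorm_ball_sub_le μ hp hw hI
  set δ : ℝ≥0∞ := ENNReal.ofReal ((b - a) / 2) with hδ
  have hδ0 : δ ≠ 0 := by simp [hδ, hab]
  set M : ℝ≥0∞ := δ⁻¹ ^ (p : ℝ≥0∞).toReal * C ^ (p : ℝ≥0∞).toReal with hMdef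
  have hM : M < ⊤ := ENNReal.mul_lt_top
    (ENNReal.rpow_lt_top_of_nonneg ENNReal.toReal_nonneg (by simp [hδ0]))
    (ENNReal.rpow_lt_top_of_nonneg ENNReal.toReal_nonneg hC)
  have key : ∀ n : ℕ, μ ({x | w x ≤ a} ∩ ball 0 ((n : ℝ) + 1)) ≤ M ∨
      μ ({x | b ≤ w x} ∩ ball 0 ((n : ℝ) + 1)) ≤ M := by
    intro n
    obtain ⟨c, hc⟩ := hCR ((n : ℝ) + 1) (by positivity)
    have hcheb := meas_ge_le_mul_pow_eLpNorm_enorm (μ.restrict (ball (0 : E) ((n : ℝ) + 1)))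
      (f := fun x => w x - c) hp0 ENNReal.coe_ne_top
      (Continuous.aestronglyMeasurable (by fun_prop)) hδ0 (by simp [hδ])
    have hle : μ.restrict (ball (0 : E) ((n : ℝ) + 1)) {x | δ ≤ ‖w x - c‖ₑ} ≤ M := by
      refine hcheb.trans ?_
      rw [hMdef]
      gcongr
    have hsub : ∀ s : Set E, s ⊆ {x | δ ≤ ‖w x - c‖ₑ} → μ (s ∩ ball 0 ((n : ℝ) + 1)) ≤ M :=
      fun s hs => by
        rw [← Measure.restrict_apply' measurableSet_ball]
        exact (measure_mono hs).trans hle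
    -- one of the two level sets stays at distance at least `(b - a) / 2` from `c`
    rcases le_total c ((a + b) / 2) with h | h
    · right
      refine hsub _ fun x hx => ?_
      rw [mem_ofPred_eq, ← ofReal_norm]
      refine ENNReal.ofReal_le_ofReal (le_trans ?_ (le_abs_self _))
      have : b ≤ w x := hx
      linarith
    · left
      refine hsub _ fun x hx => ?_
      rw [mem_ofPred_eq, ← ofReal_norm]
      refine ENNReal.ofReal_le_ofReal (le_trans ?_ (neg_le_abs _))
      have : w x ≤ a := hx
      linarith
  have hmono : ∀ s : Set E, (∃ᶠ n : ℕ in atTop, μ (s ∩ ball 0 ((n : ℝ) + 1)) ≤ M) → μ s < ⊤ := by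
    intro s hs
    have hmon : Monotone fun n : ℕ => s ∩ ball (0 : E) ((n : ℝ) + 1) := fun m n hmn =>
      inter_subset_inter_right _ (ball_subset_ball (by gcongr))
    have hun : ⋃ n : ℕ, s ∩ ball (0 : E) ((n : ℝ) + 1) = s := by
      rw [← inter_iUnion, iUnion_ball_nat_succ, inter_univ]
    have := tendsto_measure_iUnion_atTop (μ := μ) hmon
    rw [hun] at this
    exact (le_of_tendsto_of_frequently this hs).trans_lt hM
  rcases frequently_or_distrib.1 (Frequently.of_forall (f := (atTop : Filter ℕ)) key) with h | h
  · exact .inl (hmono _ h)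
  · exact .inr (hmono _ h)

end

/-! ### Mollification of weakly differentiable functions -/

theorem memLp_two_of_lintegral_sq_lt_top {α F : Type*} [MeasurableSpace α] {μ : Measure α}
    [NormedAddCommGroup F] {g : α → F} (hg : AEStronglyMeasurable g μ)
    (h : ∫⁻ x, ‖g x‖ₑ ^ 2 ∂μ < ⊤) : MemLp g 2 μ := by
  refine ⟨hg, ?_⟩
  have h2 := eLpNorm_nnreal_pow_eq_lintegral (f := g) (μ := μ) (p := 2) two_ne_zero
  simp only [NNReal.coe_ofNat, ENNReal.rpow_ofNat, ENNReal.coe_ofNat] at h2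
  rw [← h2] at h
  exact (ENNReal.pow_lt_top_iff.1 h).resolve_right two_ne_zero

theorem lintegral_sq_lt_top_of_memLp_two {α F : Type*} [MeasurableSpace α] {μ : Measure α}
    [NormedAddCommGroup F] {g : α → F} (hg : MemLp g 2 μ) : ∫⁻ x, ‖g x‖ₑ ^ 2 ∂μ < ⊤ := by
  have h2 := eLpNorm_nnreal_pow_eq_lintegral (f := g) (μ := μ) (p := 2) two_ne_zero
  simp only [NNReal.coe_ofNat, ENNReal.rpow_ofNat, ENNReal.coe_ofNat] at h2
  rw [← h2]
  exact ENNReal.pow_lt_top hg.2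

section

variable {E : Type*} [NormedAddCommGroup E] [NormedSpace ℝ E] [FiniteDimensional ℝ E]
  [MeasurableSpace E] [BorelSpace E]

/-- The probability measure whose density with respect to `μ` is the normalised bump function `η`.
Convolution with `η.normed μ` is integration of translates against this measure. -/
noncomputable def bumpMeasure (η : ContDiffBump (0 : E)) (μ : Measure E) : Measure E :=
  μ.withDensity fun x => ENNReal.ofReal (η.normed μ x)

theorem measurable_bumpDensity (η : ContDiffBump (0 : E)) (μ : Measure E) [μ.IsAddHaarMeasure] :
    Measurable fun x => ENNReal.ofReal (η.normed μ x) :=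
  η.continuous_normed.measurable.ennreal_ofReal

instance isProbabilityMeasure_bumpMeasure (η : ContDiffBump (0 : E)) (μ : Measure E)
    [μ.IsAddHaarMeasure] : IsProbabilityMeasure (bumpMeasure η μ) := by
  constructor
  rw [bumpMeasure, withDensity_apply _ MeasurableSet.univ, setLIntegral_univ,
    ← ofReal_integral_eq_lintegral_ofReal η.integrable_normed
      (.of_forall fun x => η.nonneg_normed x), η.integral_normed, ENNReal.ofReal_one]

theorem lintegral_bumpMeasure (η : ContDiffBump (0 : E)) (μ : Measure E) [μ.IsAddHaarMeasure]
    {g : E → ℝ≥0∞} (hg : Measurable g) :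
    ∫⁻ t, g t ∂bumpMeasure η μ = ∫⁻ t, ‖η.normed μ t‖ₑ * g t ∂μ := by
  rw [bumpMeasure, lintegral_withDensity_eq_lintegral_mul _ (measurable_bumpDensity η μ) hg]
  refine lintegral_congr fun t => ?_
  rw [Pi.mul_apply, Real.enorm_of_nonneg (η.nonneg_normed t)]

theorem convolution_bump_eq_integral (η : ContDiffBump (0 : E)) (μ : Measure E)
    [μ.IsAddHaarMeasure] (φ : E → ℝ) (x : E) :
    (φ ⋆[ContinuousLinearMap.lsmul ℝ ℝ, μ] η.normed μ) x = ∫ t, φ (x - t) ∂bumpMeasure η μ := by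
  rw [bumpMeasure, integral_withDensity_eq_integral_toReal_smul (measurable_bumpDensity η μ)
    (.of_forall fun x => ENNReal.ofReal_lt_top), convolution_lsmul_swap]
  refine integral_congr_ae (.of_forall fun t => ?_)
  simp only [ENNReal.toReal_ofReal (η.nonneg_normed t), smul_eq_mul, mul_comm]

/-- Young's inequality: convolution with a probability measure does not increase the `L²` norm. -/
theorem lintegral_sq_lintegral_sub_le (μ : Measure E) [μ.IsAddHaarMeasure] (ν : Measure E)
    [IsProbabilityMeasure ν] {g : E → ℝ≥0∞} (hg : Measurable g) :
    ∫⁻ x, (∫⁻ t, g (x - t) ∂ν) ^ 2 ∂μ ≤ ∫⁻ x, g x ^ 2 ∂μ := by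
  calc ∫⁻ x, (∫⁻ t, g (x - t) ∂ν) ^ 2 ∂μ
      ≤ ∫⁻ x, ∫⁻ t, g (x - t) ^ 2 ∂ν ∂μ := lintegral_mono fun x =>
        sq_lintegral_le_lintegral_sq ν (by fun_prop)
    _ = ∫⁻ t, ∫⁻ x, g (x - t) ^ 2 ∂μ ∂ν := by
        rw [lintegral_lintegral_swap]
        exact Measurable.aemeasurable (by fun_prop)
    _ = ∫⁻ x, g x ^ 2 ∂μ := by
        simp_rw [lintegral_sub_right_eq_self (μ := μ) (fun y => g y ^ 2)]
        simp

end

section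

variable {d : ℕ} {φ : EuclideanSpace ℝ (Fin d) → ℝ}
  {G : EuclideanSpace ℝ (Fin d) → EuclideanSpace ℝ (Fin d)}

theorem HasWeakGradient.contDiff_convolution_bump (hG : HasWeakGradient φ G)
    (η : ContDiffBump (0 : EuclideanSpace ℝ (Fin d))) :
    ContDiff ℝ 1 (φ ⋆[ContinuousLinearMap.lsmul ℝ ℝ, volume] η.normed volume) :=
  η.hasCompactSupport_normed.contDiff_convolution_right _ hG.locallyIntegrable
    η.contDiff_normed

/-- The gradient of the mollification is the mollification of the weak gradient, hence is bounded
pointwise by the mollification of `‖G‖`. -/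
theorem HasWeakGradient.enorm_fderiv_convolution_bump_le (hG : HasWeakGradient φ G)
    (hGm : Measurable G) (η : ContDiffBump (0 : EuclideanSpace ℝ (Fin d)))
    (x : EuclideanSpace ℝ (Fin d)) :
    ‖fderiv ℝ (φ ⋆[ContinuousLinearMap.lsmul ℝ ℝ, volume] η.normed volume) x‖ₑ ≤
      ∫⁻ t, ‖G (x - t)‖ₑ ∂bumpMeasure η volume := by
  have hη : ContDiff ℝ ∞ (η.normed (volume : Measure (EuclideanSpace ℝ (Fin d)))) :=
    η.contDiff_normed
  have hηc := η.hasCompactSupport_normed (μ := (volume : Measure (EuclideanSpace ℝ (Fin d))))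
  set g := η.normed (volume : Measure (EuclideanSpace ℝ (Fin d))) with hg
  set ψ : EuclideanSpace ℝ (Fin d) → ℝ := fun t => g (x - t) with hψdef
  have hψ : ContDiff ℝ ∞ ψ := hη.comp (contDiff_const.sub contDiff_id)
  have hψc : HasCompactSupport ψ := hηc.comp_homeomorph (Homeomorph.subLeft x)
  have hint : Integrable fun t => ψ t • G t :=
    hG.locallyIntegrable_grad.integrable_smul_left_of_hasCompactSupport hψ.continuous hψc
  have hψ' : ∀ t v, fderiv ℝ ψ t v = - fderiv ℝ g (x - t) v := by
    intro t v
    have h1 : HasFDerivAt ψ ((fderiv ℝ g (x - t)).comp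
        (-ContinuousLinearMap.id ℝ (EuclideanSpace ℝ (Fin d)))) t :=
      ((hη.differentiable (by simp) _).hasFDerivAt).comp t
        ((hasFDerivAt_id t).const_sub x)
    rw [h1.fderiv]
    simp
  have hη1 : ContDiff ℝ 1 g := hη.of_le (by simp)
  have hfd := hηc.hasFDerivAt_convolution_right (ContinuousLinearMap.lsmul ℝ ℝ)
    hG.locallyIntegrable hη1 x
  have happ : ∀ v, fderiv ℝ (φ ⋆[ContinuousLinearMap.lsmul ℝ ℝ, volume] g) x v =
      - ∫ t, φ t * fderiv ℝ ψ t v := by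
    intro v
    rw [hfd.fderiv, convolution_precompR_apply _ hG.locallyIntegrable (hηc.fderiv ℝ)
      (hη1.continuous_fderiv one_ne_zero), convolution_def, ← integral_neg]
    refine integral_congr_ae (.of_forall fun t => ?_)
    simp [hψ' t v]
  -- the definition of the weak gradient, tested with `ψ`, identifies the partial derivatives
  have hV : fderiv ℝ (φ ⋆[ContinuousLinearMap.lsmul ℝ ℝ, volume] g) x =
      innerSL ℝ (∫ t, ψ t • G t) := by
    refine ContinuousLinearMap.coe_injective
      ((EuclideanSpace.basisFun (Fin d) ℝ).toBasis.ext fun i => ?_)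
    have h1 : (∫ t, ψ t • G t) i = ∫ t, (ψ t • G t) i :=
      ((EuclideanSpace.proj i : EuclideanSpace ℝ (Fin d) →L[ℝ] ℝ).integral_comp_comm hint).symm
    simp only [OrthonormalBasis.coe_toBasis, EuclideanSpace.basisFun_apply,
      ContinuousLinearMap.coe_coe, happ, hG.integral_eq ψ hψ hψc i, neg_neg, innerSL_apply_apply,
      EuclideanSpace.inner_single_right]
    simp [h1, mul_comm]
  rw [hV, lintegral_bumpMeasure η volume (by fun_prop),
    ← lintegral_sub_left_eq_self _ x]
  calc ‖innerSL ℝ (∫ t, ψ t • G t)‖ₑ = ‖∫ t, ψ t • G t‖ₑ := by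
        rw [← ofReal_norm, innerSL_apply_norm, ofReal_norm]
    _ ≤ ∫⁻ t, ‖ψ t • G t‖ₑ := enorm_integral_le_lintegral_enorm _
    _ = _ := lintegral_congr fun t => by rw [enorm_smul, sub_sub_cancel]

theorem HasWeakGradient.lintegral_sq_fderiv_convolution_bump_le (hG : HasWeakGradient φ G)
    (hGm : Measurable G) (η : ContDiffBump (0 : EuclideanSpace ℝ (Fin d))) :
    ∫⁻ x, ‖fderiv ℝ (φ ⋆[ContinuousLinearMap.lsmul ℝ ℝ, volume] η.normed volume) x‖ₑ ^ 2 ≤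
      ∫⁻ x, ‖G x‖ₑ ^ 2 :=
  (lintegral_mono fun x => pow_le_pow_left₀ zero_le
    (hG.enorm_fderiv_convolution_bump_le hGm η x) 2).trans
    (lintegral_sq_lintegral_sub_le volume _ hGm.enorm)

/-- The `L²` translation estimate for a weakly differentiable function, obtained from that for its
mollifications by Fatou's lemma. -/
theorem HasWeakGradient.lintegral_sq_translate_sub_le (hG : HasWeakGradient φ G)
    (hGm : Measurable G) (h : EuclideanSpace ℝ (Fin d)) :
    ∫⁻ x, ‖φ (x + h) - φ x‖ₑ ^ 2 ≤ ‖h‖ₑ ^ 2 * ∫⁻ x, ‖G x‖ₑ ^ 2 := by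
  let η : ℕ → ContDiffBump (0 : EuclideanSpace ℝ (Fin d)) := fun n =>
    ⟨1 / ((n : ℝ) + 1), 2 * (1 / ((n : ℝ) + 1)), by positivity, by
      have : 0 < 1 / ((n : ℝ) + 1) := by positivity
      linarith⟩
  let f : ℕ → EuclideanSpace ℝ (Fin d) → ℝ := fun n =>
    φ ⋆[ContinuousLinearMap.lsmul ℝ ℝ, volume] (η n).normed volume
  have hf : ∀ n, ContDiff ℝ 1 (f n) := fun n => hG.contDiff_convolution_bump (η n)
  have hlim : ∀ᵐ x, Tendsto (fun n => f n x) atTop (𝓝 (φ x)) := by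
    have h0 := ContDiffBump.ae_convolution_tendsto_right_of_locallyIntegrable (φ := η)
      (l := atTop) (K := 2) (by
        have h1 := (tendsto_one_div_add_atTop_nhds_zero_nat (𝕜 := ℝ)).const_mul 2
        rw [mul_zero] at h1
        exact h1)
      (.of_forall fun n => le_rfl) hG.locallyIntegrable
    filter_upwards [h0] with x hx
    refine hx.congr fun n => ?_
    change _ = (φ ⋆[ContinuousLinearMap.lsmul ℝ ℝ, volume] (η n).normed volume) x
    rw [convolution_lsmul, convolution_lsmul_swap]
    exact integral_congr_ae (.of_forall fun t => mul_comm _ _)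
  have hlim' : ∀ᵐ x, Tendsto (fun n => f n (x + h)) atTop (𝓝 (φ (x + h))) :=
    (measurePreserving_add_right volume h).quasiMeasurePreserving.ae hlim
  calc ∫⁻ x, ‖φ (x + h) - φ x‖ₑ ^ 2
      = ∫⁻ x, liminf (fun n => ‖f n (x + h) - f n x‖ₑ ^ 2) atTop := by
        refine lintegral_congr_ae ?_
        filter_upwards [hlim, hlim'] with x hx hx'
        exact ((((ENNReal.continuous_pow 2).comp continuous_enorm).tendsto _).comp
          (hx'.sub hx)).liminf_eq.symm
    _ ≤ liminf (fun n => ∫⁻ x, ‖f n (x + h) - f n x‖ₑ ^ 2) atTop :=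
        lintegral_liminf_le fun n => by
          have := (hf n).continuous
          exact Measurable.pow_const (Continuous.measurable (by fun_prop)) 2
    _ ≤ liminf (fun _ : ℕ => ‖h‖ₑ ^ 2 * ∫⁻ x, ‖G x‖ₑ ^ 2) atTop :=
        liminf_le_liminf (.of_forall fun n =>
          (lintegral_enorm_translate_sub_sq_le volume (hf n) h).trans
            (mul_le_mul_right (hG.lintegral_sq_fderiv_convolution_bump_le hGm (η n)) _))
    _ = _ := liminf_const _

/-- A bounded function with square-integrable weak gradient differs from its mollification by a
square-integrable function, although neither of the two needs to be square-integrable. -/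
theorem HasWeakGradient.memLp_sub_convolution_bump (hG : HasWeakGradient φ G)
    (hGm : Measurable G) (hG2 : MemLp G 2) (hφm : Measurable φ) (hφ : ∀ x, ‖φ x‖ ≤ 1)
    (η : ContDiffBump (0 : EuclideanSpace ℝ (Fin d))) :
    MemLp (fun x => φ x - (φ ⋆[ContinuousLinearMap.lsmul ℝ ℝ, volume] η.normed volume) x) 2 := by
  have hfm := (hG.contDiff_convolution_bump η).continuous.measurable
  refine memLp_two_of_lintegral_sq_lt_top (hφm.sub hfm).aestronglyMeasurable ?_
  set ν := bumpMeasure η (volume : Measure (EuclideanSpace ℝ (Fin d))) with hν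
  have hpt : ∀ x, ‖φ x - (φ ⋆[ContinuousLinearMap.lsmul ℝ ℝ, volume] η.normed volume) x‖ₑ ^ 2 ≤
      ∫⁻ t, ‖φ (x + -t) - φ x‖ₑ ^ 2 ∂ν := by
    intro x
    have hi : Integrable (fun t => φ (x - t)) ν :=
      .of_bound (Measurable.aestronglyMeasurable (by fun_prop)) 1 (.of_forall fun t => hφ _)
    have heq : (φ ⋆[ContinuousLinearMap.lsmul ℝ ℝ, volume] η.normed volume) x - φ x =
        ∫ t, (φ (x + -t) - φ x) ∂ν := by
      simp_rw [← sub_eq_add_neg]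
      rw [integral_sub hi (integrable_const _), convolution_bump_eq_integral]
      simp [hν]
    rw [enorm_sub_rev, heq]
    exact (pow_le_pow_left₀ zero_le (enorm_integral_le_lintegral_enorm _) 2).trans
      (sq_lintegral_le_lintegral_sq ν (by fun_prop))
  calc _ ≤ ∫⁻ x, ∫⁻ t, ‖φ (x + -t) - φ x‖ₑ ^ 2 ∂ν := lintegral_mono hpt
    _ = ∫⁻ t, ∫⁻ x, ‖φ (x + -t) - φ x‖ₑ ^ 2 ∂volume ∂ν := by
        rw [lintegral_lintegral_swap]
        exact Measurable.aemeasurable (by fun_prop)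
    _ ≤ ∫⁻ t, ‖t‖ₑ ^ 2 * ∫⁻ x, ‖G x‖ₑ ^ 2 ∂volume ∂ν := lintegral_mono fun t => by
        simpa using hG.lintegral_sq_translate_sub_le hGm (-t)
    _ ≤ ∫⁻ t, ENNReal.ofReal η.rOut ^ 2 * ∫⁻ x, ‖G x‖ₑ ^ 2 ∂volume ∂ν := by
        rw [lintegral_bumpMeasure η volume (by fun_prop),
          lintegral_bumpMeasure η volume (by fun_prop)]
        refine lintegral_mono fun t => ?_
        -- the density of `ν` vanishes outside the ball of radius `η.rOut`
        by_cases ht : t ∈ ball (0 : EuclideanSpace ℝ (Fin d)) η.rOut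
        · gcongr
          rw [← ofReal_norm]
          exact ENNReal.ofReal_le_ofReal (mem_ball_zero_iff.1 ht).le
        · rw [← η.support_normed_eq (μ := volume), Function.notMem_support] at ht
          simp [ht]
    _ < ⊤ := by
        have := lintegral_sq_lt_top_of_memLp_two hG2
        rw [lintegral_const, measure_univ, mul_one]
        exact ENNReal.mul_lt_top (by finiteness) this

end

/-! ### The phase function after mollification -/

section

variable {d : ℕ} {φ : EuclideanSpace ℝ (Fin d) → ℝ}
  {G : EuclideanSpace ℝ (Fin d) → EuclideanSpace ℝ (Fin d)}

theorem HasWeakGradient.congr_ae (hG : HasWeakGradient φ G)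
    {φ' : EuclideanSpace ℝ (Fin d) → ℝ}
    {G' : EuclideanSpace ℝ (Fin d) → EuclideanSpace ℝ (Fin d)}
    (h : φ =ᵐ[volume] φ') (h' : G =ᵐ[volume] G') : HasWeakGradient φ' G' := by
  refine ⟨hG.1.congr h, hG.2.congr h', fun ψ hψ hψc i => ?_⟩
  have h1 : ∫ x, φ' x * fderiv ℝ ψ x (EuclideanSpace.single i 1) =
      ∫ x, φ x * fderiv ℝ ψ x (EuclideanSpace.single i 1) :=
    integral_congr_ae (h.mono fun x hx => by simp only [hx])
  have h2 : ∫ x, G' x i * ψ x = ∫ x, G x i * ψ x :=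
    integral_congr_ae (h'.mono fun x hx => by simp only [hx])
  rw [h1, h2, hG.3 ψ hψ hψc i]

/-- Regularisation of `φ`. The bounds hold everywhere for `φ`, but measurability only up to null
sets, so a truncated measurable representative is mollified. -/
theorem HasWeakGradient.exists_contDiff_approx (hG : HasWeakGradient φ G)
    (hG2 : MemLp G 2) (hφ : ∀ x, φ x ∈ Icc (-1 : ℝ) 1) :
    ∃ f : EuclideanSpace ℝ (Fin d) → ℝ, ContDiff ℝ 1 f ∧ (∀ x, f x ∈ Icc (-1 : ℝ) 1) ∧
      MemLp (fderiv ℝ f) 2 ∧ MemLp (fun x => φ x - f x) 2 := by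
  have hφs := hG.locallyIntegrable.aestronglyMeasurable
  set φ' : EuclideanSpace ℝ (Fin d) → ℝ := fun x => max (-1) (min 1 (hφs.mk φ x)) with hφ'
  have hae : φ =ᵐ[volume] φ' := by
    filter_upwards [hφs.ae_eq_mk] with x hx
    simp only [hφ', ← hx]
    rw [min_eq_right (hφ x).2, max_eq_right (hφ x).1]
  have hm : Measurable φ' :=
    measurable_const.max (measurable_const.min hφs.stronglyMeasurable_mk.measurable)
  have hb : ∀ x, ‖φ' x‖ ≤ 1 := fun x =>
    abs_le.2 ⟨le_max_left _ _, max_le (by norm_num) (min_le_left _ _)⟩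
  set G' := hG2.1.mk G
  have hGm : Measurable G' := hG2.1.stronglyMeasurable_mk.measurable
  have hG2' : MemLp G' 2 := hG2.ae_eq hG2.1.ae_eq_mk
  have hw : HasWeakGradient φ' G' := hG.congr_ae hae hG2.1.ae_eq_mk
  let η : ContDiffBump (0 : EuclideanSpace ℝ (Fin d)) := ⟨1, 2, one_pos, one_lt_two⟩
  have hf := hw.contDiff_convolution_bump η
  refine ⟨_, hf, fun x => ?_, ?_, ?_⟩
  · rw [convolution_bump_eq_integral]
    refine abs_le.1 ?_
    simpa using norm_integral_le_of_norm_le_const (μ := bumpMeasure η volume)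
      (.of_forall fun t => hb (x - t))
  · exact memLp_two_of_lintegral_sq_lt_top
      (hf.continuous_fderiv one_ne_zero).aestronglyMeasurable
      ((hw.lintegral_sq_fderiv_convolution_bump_le hGm η).trans_lt
        (lintegral_sq_lt_top_of_memLp_two hG2'))
  · refine (hw.memLp_sub_convolution_bump hGm hG2' hm hb η).ae_eq ?_
    filter_upwards [hae] with x hx
    rw [hx]

/-- The Modica-Mortola trick: the gradient of `f - f ^ 3 / 3` is `(1 - f ^ 2) • ∇f`, a product of
two square-integrable functions. -/
theorem lintegral_enorm_fderiv_sub_cube_lt_top {E : Type*} [NormedAddCommGroup E]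
    [NormedSpace ℝ E] [MeasurableSpace E] {μ : Measure E}
    {f : E → ℝ} (hf : Differentiable ℝ f) (hf' : MemLp (fderiv ℝ f) 2 μ)
    (hf2 : MemLp (fun x => 1 - f x ^ 2) 2 μ) :
    ∫⁻ x, ‖fderiv ℝ (fun x => f x - f x ^ 3 / 3) x‖ₑ ∂μ < ⊤ := by
  have hi : Integrable (fun x => (1 - f x ^ 2) * ‖fderiv ℝ f x‖) μ := hf2.integrable_mul hf'.norm
  refine lt_of_eq_of_lt (lintegral_congr fun x => ?_) hi.2
  have hd : HasFDerivAt (fun x => f x - f x ^ 3 / 3) ((1 - f x ^ 2) • fderiv ℝ f x) x := by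
    have h1 : HasDerivAt (fun t : ℝ => t - t ^ 3 / 3) (1 - f x ^ 2) (f x) := by
      have h := (hasDerivAt_id (f x)).sub ((hasDerivAt_pow 3 (f x)).div_const 3)
      exact h.congr_deriv (by norm_num)
    exact h1.comp_hasFDerivAt x (hf x).hasFDerivAt
  rw [hd.fderiv, enorm_smul, enorm_mul, enorm_norm]

/-- If `√(1 - φ ^ 2)` is square-integrable, then so is `1 - f ^ 2` for every `f` with values in
`[-1, 1]` at finite `L²` distance from `φ`. -/
theorem memLp_one_sub_sq {α : Type*} [MeasurableSpace α] {μ : Measure α} {φ f : α → ℝ}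
    (hφm : AEStronglyMeasurable φ μ) (hfm : AEStronglyMeasurable f μ)
    (hφ : ∀ x, φ x ∈ Icc (-1 : ℝ) 1) (hf : ∀ x, f x ∈ Icc (-1 : ℝ) 1)
    (hφ2 : MemLp (fun x => Real.sqrt (1 - φ x ^ 2)) 2 μ)
    (hφf : MemLp (fun x => φ x - f x) 2 μ) :
    MemLp (fun x => 1 - f x ^ 2) 2 μ := by
  have h1 : MemLp (fun x => 1 - φ x ^ 2) 2 μ := by
    refine hφ2.of_le (aestronglyMeasurable_const.sub (hφm.pow 2)) (.of_forall fun x => ?_)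
    have h0 : 0 ≤ 1 - φ x ^ 2 := by nlinarith [(hφ x).1, (hφ x).2]
    rw [Real.norm_of_nonneg h0, Real.norm_of_nonneg (Real.sqrt_nonneg _)]
    exact Real.le_sqrt_of_sq_le (by nlinarith [sq_nonneg (φ x)])
  have h2 : MemLp (fun x => (φ x - f x) * (φ x + f x)) 2 μ := by
    refine hφf.of_le_mul (c := 2) ((hφm.sub hfm).mul (hφm.add hfm)) (.of_forall fun x => ?_)
    rw [norm_mul, mul_comm]
    refine mul_le_mul_of_nonneg_right (abs_le.2 ⟨?_, ?_⟩) (norm_nonneg _)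
    · linarith [(hφ x).1, (hf x).1]
    · linarith [(hφ x).2, (hf x).2]
  refine (h1.add h2).ae_eq (.of_forall fun x => ?_)
  simp only [Pi.add_apply]
  ring

theorem integrable_one_sub_of_measure_lt_top {α : Type*} [MeasurableSpace α] {μ : Measure α}
    {φ : α → ℝ} (hφm : AEStronglyMeasurable φ μ) (hφ : ∀ x, φ x ∈ Icc (-1 : ℝ) 1)
    (hφ2 : Integrable (fun x => 1 - φ x ^ 2) μ) (hfin : μ {x | φ x ≤ -(1 / 2)} < ⊤) :
    Integrable (fun x => 1 - φ x) μ := by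
  have hs : NullMeasurableSet {x | φ x ≤ -(1 / 2)} μ :=
    nullMeasurableSet_le hφm.aemeasurable aemeasurable_const
  have hi : Integrable ({x | φ x ≤ -(1 / 2)}.indicator fun _ => (2 : ℝ)) μ :=
    (integrableOn_const hfin.ne).integrable_indicator₀ hs
  refine ((hφ2.const_mul 2).add hi).mono' (aestronglyMeasurable_const.sub hφm)
    (.of_forall fun x => ?_)
  obtain ⟨h1, h2⟩ := hφ x
  rw [Real.norm_of_nonneg (by linarith), Pi.add_apply]
  by_cases hx : φ x ≤ -(1 / 2)
  · rw [indicator_of_mem (by exact hx)]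
    nlinarith
  · rw [indicator_of_notMem (by exact hx)]
    push Not at hx
    nlinarith

/-- If `‖g‖` is at least `1 / 4` on `s` outside a set of finite measure, and `g` is in `L²`, then
`s` has finite measure by Chebyshev's inequality. -/
theorem measure_lt_top_of_memLp_two_of_le_norm {α : Type*} [MeasurableSpace α] {μ : Measure α}
    {g : α → ℝ} (hg : MemLp g 2 μ) {s t : Set α} (ht : μ t < ⊤)
    (hst : ∀ x ∈ s, x ∉ t → 1 / 4 ≤ ‖g x‖) : μ s < ⊤ := by
  have hc := meas_ge_le_mul_pow_eLpNorm_enorm μ two_ne_zero ENNReal.ofNat_ne_top hg.1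
    (ε := ENNReal.ofReal (1 / 4)) (by simp) (by simp)
  have hfin : μ {x | ENNReal.ofReal (1 / 4) ≤ ‖g x‖ₑ} < ⊤ := hc.trans_lt
    (ENNReal.mul_lt_top (ENNReal.rpow_lt_top_of_nonneg (by simp) (by simp))
      (ENNReal.rpow_lt_top_of_nonneg (by simp) hg.2.ne))
  refine (measure_mono fun x hx => ?_).trans_lt (measure_union_lt_top ht hfin)
  by_cases hxt : x ∈ t
  · exact .inl hxt
  · refine .inr ?_
    rw [mem_ofPred_eq, ← ofReal_norm]
    exact ENNReal.ofReal_le_ofReal (hst x hx hxt)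

theorem monotoneOn_sub_cube : MonotoneOn (fun t : ℝ => t - t ^ 3 / 3) (Icc (-1) 1) := by
  intro x hx y hy hxy
  have h1 : 0 ≤ 3 - (x ^ 2 + x * y + y ^ 2) := by
    nlinarith [hx.1, hx.2, hy.1, hy.2, sq_nonneg (x - y)]
  have h2 := mul_nonneg (sub_nonneg.2 hxy) h1
  change x - x ^ 3 / 3 ≤ y - y ^ 3 / 3
  nlinarith

end

theorem mainTheorem4 {d : ℕ} (hd : 2 ≤ d)
    (φ : EuclideanSpace ℝ (Fin d) → ℝ)
    (hφ : ∀ x, φ x ∈ Icc (-1 : ℝ) 1)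
    (G : EuclideanSpace ℝ (Fin d) → EuclideanSpace ℝ (Fin d))
    (hG : HasWeakGradient φ G)
    (hG2 : MemLp G 2 volume)
    (hφ2 : MemLp (fun x => Real.sqrt (1 - φ x ^ 2)) 2 volume) :
    Integrable (fun x => 1 - φ x) volume ∨ Integrable (fun x => 1 + φ x) volume := by
  have hφm := hG.locallyIntegrable.aestronglyMeasurable
  obtain ⟨f, hf, hfb, hf', hφf⟩ := hG.exists_contDiff_approx hG2 hφ
  have hw : ContDiff ℝ 1 fun x => f x - f x ^ 3 / 3 := hf.sub ((hf.pow 3).div_const 3)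
  have hI := lintegral_enorm_fderiv_sub_cube_lt_top (hf.differentiable one_ne_zero) hf'
    (memLp_one_sub_sq hφm hf.continuous.aestronglyMeasurable hφ hfb hφ2 hφf)
  have h1 : Integrable (fun x => 1 - φ x ^ 2) volume :=
    hφ2.integrable_sq.congr (.of_forall fun x => Real.sq_sqrt (by
      nlinarith [(hφ x).1, (hφ x).2]))
  -- `47 / 192` is the value of `t - t ^ 3 / 3` at `t = 1 / 4`
  rcases measure_le_lt_top_or_measure_ge_lt_top volume (by simpa using hd) hw hI.ne
    (a := -(47 / 192)) (b := 47 / 192) (by norm_num) with h | h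
  · left
    refine integrable_one_sub_of_measure_lt_top hφm hφ h1
      (measure_lt_top_of_memLp_two_of_le_norm hφf h fun x hx hxt => ?_)
    have hx' : φ x ≤ -(1 / 2) := hx
    have hfx : -(1 / 4) < f x := by
      by_contra! hle
      refine hxt ?_
      exact (monotoneOn_sub_cube (hfb x) (b := -(1 / 4)) (by norm_num) hle).trans_eq
        (by norm_num)
    exact le_trans (by linarith) (neg_le_abs _)
  · right
    have := integrable_one_sub_of_measure_lt_top (φ := fun x => - φ x) hφm.neg
      (fun x => ⟨by linarith [(hφ x).2], by linarith [(hφ x).1]⟩) (by simpa using h1)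
      (measure_lt_top_of_memLp_two_of_le_norm hφf h fun x hx hxt => ?_)
    · simpa using this
    have hx' : - φ x ≤ -(1 / 2) := hx
    have hfx : f x < 1 / 4 := by
      by_contra! hle
      refine hxt ?_
      exact le_of_eq_of_le (by norm_num)
        (monotoneOn_sub_cube (a := 1 / 4) (by norm_num) (hfb x) hle)
    exact le_trans (by linarith) (le_abs_self _)
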